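/- **Setting.** Let $(\Omega,\Sigma,\mathbb P)$ be a probability space and let $(a_n,b_n)_{n\ge 1}$ be random pairs in $\mathbb R^D\times\mathbb R$ with finite second moments such that $b_n=a_n^{\top}\theta_*+\eta_n$ almost surely for some $\theta_*\in\mathbb R^D$, where the noise process $(\eta_n)_n$ has zero mean and is independent of the process $(a_n)_n$, and $R:=\mathbb E(a_na_n^{\top})$, $r:=\mathbb E(b_na_n)$ and $\mathbb E(b_n^2)$ do not depend on $n$. For $n\ge1$ let $R_n:=\frac1n\sum_{\nu=1}^n a_\nu a_\nu^{\top}$ and $r_n:=\frac1n\sum_{\nu=1}^n b_\nu a_\nu$, and fix a deterministic matrix $R_0$ and deterministic vectors $r_0,x_0$. The hierarchical least-squares problem (HLS) is to minimize $\|x\|_1$ over $\mathcal A:=\arg\min_{x'\in\mathbb R^D}\mathbb E\big[\sum_{\nu=1}^n(a_\nu^{\top}x'-b_\nu)^2\big]$, a set that is the same for all $n\ge1$. **Algorithms.** Let $\alpha\in[\frac12,1)$, $\lambda>0$, and let $\varpi>0$ be a constant with $\varpi\ge\max\{\|R\|,\|R_n\|\}$ almost surely for all $n\ge0$ (spectral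 norm). For affine maps $T_n=Q_n+\pi_n$ put $T_n^{(\alpha)}:=\alpha T_n+(1-\alpha)\mathrm{Id}$ and define $(x_n)_{n\ge 0}$ by $$x_{1/2}=T_0^{(\alpha)}x_0,\qquad x_{n+1/2}=x_{n-1/2}-T_{n-1}^{(\alpha)}x_{n-1}+T_nx_n\ (n\ge1),\qquad x_{n+1}=\operatorname{prox}_{\lambda\|\cdot\|_1}(x_{n+1/2})\ (n\ge0).$$ HRLSa is this recursion with $T_nx=x-\frac1\varpi(R_nx-r_n)$; its target map $T=Q+\pi$ is $Tx=x-\frac1\varpi(Rx-r)$. HRLSb is this recursion with $T_nx=(I+\kappa R_n)^{-1}(x+\kappa r_n)$ for some $\kappa>0$ (with $I+\kappa R_0$ invertible); its target map is $Tx=(I+\kappa R)^{-1}(x+\kappa r)$. In both cases the proximal map is soft thresholding, $[\operatorname{prox}_{\lambda\|\cdot\|_1}(y)]_d=[y]_d\,(1-\lambda/\max\{\lambda,|[y]_d|\})$. **Assumptions.** 1. (Pointwise ergodicity) $R_n\to R$ and $r_n\to r$ almost surely. 2. (Domination) Let $U$ be the positive square root of $I-Q$. There are $x_*\in\mathcal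 A$ and $v_*\in\mathbb R^D$ such that $\xi_*:=-Uv_*/\lambda\in\partial\|\cdot\|_1(x_*)$ and the following holds. With $\xi_{n+1}:=(x_{n+1/2}-x_{n+1})/\lambda$ and $$\begin{aligned}\vartheta_n:={}&2(1-2\alpha)\langle x_{n+1}-x_*,(T-T_{n+1})x_{n+1}\rangle+2\alpha\langle x_{n+1}-x_*,(Q-Q_{n+1})(x_{n+1}-x_n)\rangle\\&+2\alpha\langle x_{n+1}-x_*,(T_n-T_{n+1})x_n\rangle+2(1-\alpha)\Big\langle x_{n+1}-x_*,\sum_{\nu=1}^{n+1}(T_\nu-T)x_\nu\Big\rangle\\&+2\lambda\langle x_*-x_{n+1},\xi_{n+1}-\xi_*\rangle,\end{aligned}$$ and $\mathcal F_n:=\sigma(x_0,\dots,x_n)$, there is a non-negative random variable $\psi$ with $\mathbb E\psi<\infty$ and $\sum_{n\ge0}\max\{0,\mathbb E(\vartheta_n\mid\mathcal F_n)\}\le\psi$ almost surely. 3. (Bounded variance) There is $C>0$ with $\mathbb E\|\pi_n-\pi\|^2\le C$ for all $n$. 4. $R$ is nonsingular. **Conclusion.** For the sequence $(x_n)_n$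 generated by either HRLSa or HRLSb (assumptions 2 and 3 being made for the maps of the algorithm at hand), almost surely the set of cluster points of $(x_n)_n$ is non-empty and each of its cluster points solves (HLS). -/

import Mathlib

open MeasureTheory ProbabilityTheory Filter Topology

noncomputable section

namespace HRLS

/-- The Euclidean space `ℝ^D`. -/
abbrev Vec (D : ℕ) := EuclideanSpace ℝ (Fin D)

/-- Real `D × D` matrices. -/
abbrev Mat (D : ℕ) := Matrix (Fin D) (Fin D) ℝ

variable {D : ℕ} {Ω : Type*}

/-- The matrix `M`, acting on `ℝ^D`. -/
def act (M : Mat D) (x : Vec D) : Vec D := Matrix.toEuclideanCLM (n := Fin D) (𝕜 := ℝ) M x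

/-- The spectral norm of a matrix. -/
def specNorm (M : Mat D) : ℝ := ‖Matrix.toEuclideanCLM (n := Fin D) (𝕜 := ℝ) M‖

/-- The matrix `a aᵀ`. -/
def outer (a : Vec D) : Mat D := Matrix.of fun i j => a i * a j

/-- The `ℓ₁`-norm. -/
def l1 (x : Vec D) : ℝ := ∑ d, |x d|

/-- The subdifferential of a real-valued function at `z`. -/
def subdiff (φ : Vec D → ℝ) (z : Vec D) : Set (Vec D) :=
  {ξ | ∀ x, φ z + inner ℝ ξ (x - z) ≤ φ x}

/-- `z = prox_{lam φ}(x)`: `z` is the minimizer of `½‖a - x‖² + lam φ(a)` over `a`. -/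
def IsProx (lam : ℝ) (φ : Vec D → ℝ) (x z : Vec D) : Prop :=
  ∀ a, a ≠ z → (1 / 2) * ‖z - x‖ ^ 2 + lam * φ z < (1 / 2) * ‖a - x‖ ^ 2 + lam * φ a

/-- Soft thresholding, `[y]_d ↦ [y]_d (1 - lam / max {lam, |[y]_d|})`. -/
def softThreshold (lam : ℝ) (y : Vec D) : Vec D :=
  WithLp.toLp 2 fun d => y d * (1 - lam / max lam |y d|)

/-- The running average `R_n = (1/n) ∑_{ν=1}^n a_ν a_νᵀ` for `n ≥ 1`, with a prescribed `R_0`. -/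
def runR (R0 : Mat D) (a : ℕ+ → Ω → Vec D) (n : ℕ) (ω : Ω) : Mat D :=
  if n = 0 then R0 else (1 / (n : ℝ)) • ∑ k ∈ Finset.range n, outer (a k.succPNat ω)

/-- The running average `r_n = (1/n) ∑_{ν=1}^n b_ν a_ν` for `n ≥ 1`, with a prescribed `r_0`. -/
def runr (r0 : Vec D) (a : ℕ+ → Ω → Vec D) (b : ℕ+ → Ω → ℝ) (n : ℕ) (ω : Ω) : Vec D :=
  if n = 0 then r0 else
    (1 / (n : ℝ)) • ∑ k ∈ Finset.range n, b k.succPNat ω • a k.succPNat ω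

/-- The linear regression model `b_n = a_nᵀ θ + η_n` with zero-mean noise independent of the
regressors and constant second-order statistics `R = E(a_n a_nᵀ)`, `r = E(b_n a_n)`, `E(b_n²)`. -/
structure RegressionModel [MeasurableSpace Ω] (μ : Measure Ω) (a : ℕ+ → Ω → Vec D)
    (b η : ℕ+ → Ω → ℝ) (θ : Vec D) (R : Mat D) (r : Vec D) : Prop where
  measurable_a : ∀ n, Measurable (a n)
  measurable_b : ∀ n, Measurable (b n)
  measurable_η : ∀ n, Measurable (η n)
  memLp_a : ∀ n, MemLp (a n) 2 μ
  memLp_b : ∀ n, MemLp (b n) 2 μ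
  regression : ∀ n, ∀ᵐ ω ∂μ, b n ω = inner ℝ (a n ω) θ + η n ω
  noise_mean : ∀ n, Integrable (η n) μ ∧ ∫ ω, η n ω ∂μ = 0
  noise_indep : IndepFun (fun ω n => η n ω) (fun ω n => a n ω) μ
  autocorr : ∀ n i j, ∫ ω, a n ω i * a n ω j ∂μ = R i j
  crosscorr : ∀ n i, ∫ ω, b n ω * a n ω i ∂μ = r i
  power : ∃ s : ℝ, ∀ n, ∫ ω, (b n ω) ^ 2 ∂μ = s

/-- The ensemble least-squares loss `E[∑_{ν=1}^n (a_νᵀ x - b_ν)²]`. -/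
def lsLoss [MeasurableSpace Ω] (μ : Measure Ω) (a : ℕ+ → Ω → Vec D) (b : ℕ+ → Ω → ℝ) (n : ℕ)
    (x : Vec D) : ℝ :=
  ∫ ω, ∑ k ∈ Finset.range n, (inner ℝ (a k.succPNat ω) x - b k.succPNat ω) ^ 2 ∂μ

/-- The set of minimizers of the ensemble least-squares loss. -/
def lsArgmin [MeasurableSpace Ω] (μ : Measure Ω) (a : ℕ+ → Ω → Vec D) (b : ℕ+ → Ω → ℝ) (n : ℕ) :
    Set (Vec D) :=
  {x | ∀ y, lsLoss μ a b n x ≤ lsLoss μ a b n y}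

/-- `x` solves the hierarchical least-squares problem: it minimizes the `ℓ₁`-norm over the
minimizers of the ensemble least-squares loss, for every `n ≥ 1`. -/
def IsHLSSolution [MeasurableSpace Ω] (μ : Measure Ω) (a : ℕ+ → Ω → Vec D) (b : ℕ+ → Ω → ℝ)
    (x : Vec D) : Prop :=
  ∀ n : ℕ, 1 ≤ n → x ∈ lsArgmin μ a b n ∧ ∀ y ∈ lsArgmin μ a b n, l1 x ≤ l1 y

/-- An affine mapping `T = Q + π` of `ℝ^D`, with linear part `Q` and offset `π`. -/
structure AffMap (D : ℕ) where
  lin : Mat D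
  off : Vec D

/-- The value `T x = Q x + π`. -/
def AffMap.app (T : AffMap D) (x : Vec D) : Vec D := act T.lin x + T.off

/-- The averaged mapping `α T + (1 - α) Id`. -/
def AffMap.avg (α : ℝ) (T : AffMap D) (x : Vec D) : Vec D := α • T.app x + (1 - α) • x

/-- The gradient-type mapping `(I - ϖ⁻¹ R) + ϖ⁻¹ r`. -/
def gradMap (ϖ : ℝ) (R : Mat D) (r : Vec D) : AffMap D := ⟨1 - (1 / ϖ) • R, (1 / ϖ) • r⟩

/-- The proximal-type mapping `(I + κ R)⁻¹ + κ (I + κ R)⁻¹ r`. -/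
def proxMap (κ : ℝ) (R : Mat D) (r : Vec D) : AffMap D :=
  ⟨(1 + κ • R)⁻¹, κ • act (1 + κ • R)⁻¹ r⟩

/-- The HRLSa recursion; `xh n` stands for the half-step iterate `x_{n+1/2}`. -/
structure IsHRLSa (α lam ϖ : ℝ) (R : ℕ → Mat D) (r : ℕ → Vec D) (x0 : Vec D)
    (x xh : ℕ → Vec D) : Prop where
  init : x 0 = x0
  half_zero : xh 0 = x 0 - (α * (1 / ϖ)) • (act (R 0) (x 0) - r 0)
  half_succ : ∀ n, xh (n + 1) = x (n + 1) + xh n - x n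
      + (α * (1 / ϖ)) • (act (R n) (x n) - r n)
      - (1 / ϖ) • (act (R (n + 1)) (x (n + 1)) - r (n + 1))
  step : ∀ n, x (n + 1) = softThreshold lam (xh n)

/-- The S-FM-HSDM recursion with mappings `T_n`, losses `f_n = h_n = 0` and regularizer `g`;
`xh n` stands for the half-step iterate `x_{n+1/2}`. -/
structure IsSFMHSDM (α lam : ℝ) (T : ℕ → AffMap D) (g : Vec D → ℝ) (x0 : Vec D)
    (x xh : ℕ → Vec D) : Prop where
  init : x 0 = x0
  half_zero : xh 0 = (T 0).avg α (x 0)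
  half_succ : ∀ n, xh (n + 1) = xh n - (T n).avg α (x n) + (T (n + 1)).app (x (n + 1))
  step : ∀ n, IsProx lam g (xh n) (x (n + 1))

/-- HRLSb is S-FM-HSDM with the proximal-type mappings and the `ℓ₁`-norm as regularizer. -/
def IsHRLSb (α lam κ : ℝ) (R : ℕ → Mat D) (r : ℕ → Vec D) (x0 : Vec D)
    (x xh : ℕ → Vec D) : Prop :=
  IsSFMHSDM α lam (fun n => proxMap κ (R n) (r n)) l1 x0 x xh

/-- Pointwise ergodicity: `R - R_n → 0` and `r - r_n → 0` almost surely. -/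
def PointwiseErgodic [MeasurableSpace Ω] (μ : Measure Ω) (R : Mat D) (r : Vec D)
    (Rn : ℕ → Ω → Mat D) (rn : ℕ → Ω → Vec D) : Prop :=
  (∀ᵐ ω ∂μ, Tendsto (fun n => R - Rn n ω) atTop (𝓝 0)) ∧
    ∀ᵐ ω ∂μ, Tendsto (fun n => r - rn n ω) atTop (𝓝 0)

/-- Bounded variance of the offsets: `E‖π_n - π‖² ≤ C` for all `n`. -/
def BoundedOffsetVariance [MeasurableSpace Ω] (μ : Measure Ω) (T : AffMap D)
    (Tn : ℕ → Ω → AffMap D) : Prop :=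
  ∃ C : ℝ, 0 < C ∧ ∀ n, ∫⁻ ω, ‖(Tn n ω).off - T.off‖ₑ ^ 2 ∂μ ≤ ENNReal.ofReal C

/-- The filtration `F_n = σ(x_0, …, x_n)`. -/
abbrev pastSigma (x : ℕ → Ω → Vec D) (n : ℕ) : MeasurableSpace Ω :=
  MeasurableSpace.comap (fun ω (ν : Fin (n + 1)) => x ν ω) inferInstance

/-- The subgradient `ξ_{n+1}` of `g` at `x_{n+1}` given by `x_{n+1/2} = x_{n+1} + lam ξ_{n+1}`. -/
def xiSucc (lam : ℝ) (x xh : ℕ → Vec D) (n : ℕ) : Vec D := (1 / lam) • (xh n - x (n + 1))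

/-- The quantity `ϑ_n` (with `f = f_n = 0`). -/
def vartheta (α lam : ℝ) (T : AffMap D) (Tn : ℕ → AffMap D) (x xh : ℕ → Vec D)
    (xs ξs : Vec D) (n : ℕ) : ℝ :=
  2 * (1 - 2 * α) * inner ℝ (x (n + 1) - xs) (T.app (x (n + 1)) - (Tn (n + 1)).app (x (n + 1)))
  + 2 * α * inner ℝ (x (n + 1) - xs) (act (T.lin - (Tn (n + 1)).lin) (x (n + 1) - x n))
  + 2 * α * inner ℝ (x (n + 1) - xs) ((Tn n).app (x n) - (Tn (n + 1)).app (x n))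
  + 2 * (1 - α) * inner ℝ (x (n + 1) - xs)
      (∑ ν ∈ Finset.Icc 1 (n + 1), ((Tn ν).app (x ν) - T.app (x ν)))
  + 2 * lam * inner ℝ (xs - x (n + 1)) (xiSucc lam x xh n - ξs)

/-- Domination of the positive parts of `E(ϑ_n | F_n)`. The reference pair `(xs, vs)` has `xs` in
the constraint set `A` and `-U vs / lam` in the subdifferential of the `ℓ₁`-norm at `xs`, where `U`
is the positive square root of `I - Q`. -/
def Domination [MeasurableSpace Ω] (μ : Measure Ω) (α lam : ℝ) (A : Set (Vec D)) (T : AffMap D)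
    (Tn : ℕ → Ω → AffMap D) (x xh : ℕ → Ω → Vec D) : Prop :=
  ∃ U : Mat D, U.PosSemidef ∧ U * U = 1 - T.lin ∧
  ∃ xs vs : Vec D, xs ∈ A ∧ -((1 / lam) • act U vs) ∈ subdiff l1 xs ∧
  ∃ ψ : Ω → ℝ, Measurable ψ ∧ (∀ ω, 0 ≤ ψ ω) ∧ Integrable ψ μ ∧
    ∀ᵐ ω ∂μ, ∀ N : ℕ, ∑ n ∈ Finset.range N,
      max 0 (condExp (pastSigma x n) μ
        (fun ω' => vartheta α lam T (fun m => Tn m ω') (fun m => x m ω') (fun m => xh m ω')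
          xs (-((1 / lam) • act U vs)) n) ω) ≤ ψ ω

/-- The conclusion: almost surely the sequence has a cluster point, and all its cluster points
solve the hierarchical least-squares problem. -/
def ClusterPointsSolveHLS [MeasurableSpace Ω] (μ : Measure Ω) (a : ℕ+ → Ω → Vec D)
    (b : ℕ+ → Ω → ℝ) (x : ℕ → Ω → Vec D) : Prop :=
  ∀ᵐ ω ∂μ, (∃ z, MapClusterPt z atTop (fun n => x n ω)) ∧
    ∀ z, MapClusterPt z atTop (fun n => x n ω) → IsHLSSolution μ a b z

end HRLS

end

noncomputable section

namespace HRLS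

variable {D : ℕ} {Ω : Type*}

@[simp] lemma act_add (M : Mat D) (x y : Vec D) : act M (x + y) = act M x + act M y :=
  map_add _ x y

@[simp] lemma act_sub (M : Mat D) (x y : Vec D) : act M (x - y) = act M x - act M y :=
  map_sub _ x y

@[simp] lemma act_smul (M : Mat D) (c : ℝ) (x : Vec D) : act M (c • x) = c • act M x :=
  map_smul _ c x

@[simp] lemma act_zero (M : Mat D) : act M 0 = 0 := map_zero _

@[simp] lemma add_act (M N : Mat D) (x : Vec D) : act (M + N) x = act M x + act N x := by
  simp [act]

@[simp] lemma sub_act (M N : Mat D) (x : Vec D) : act (M - N) x = act M x - act N x := by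
  simp [act]

@[simp] lemma smul_act (c : ℝ) (M : Mat D) (x : Vec D) : act (c • M) x = c • act M x := by
  simp [act]

@[simp] lemma one_act (x : Vec D) : act (1 : Mat D) x = x := by
  simp [act]

lemma mul_act (M N : Mat D) (x : Vec D) : act (M * N) x = act M (act N x) := by
  simp [act]

lemma act_apply (M : Mat D) (x : Vec D) (i : Fin D) : act M x i = ∑ j, M i j * x j := by
  have : (act M x).ofLp = M.mulVec x.ofLp := Matrix.ofLp_toEuclideanCLM M x
  rw [this]; rfl

lemma norm_act_le (M : Mat D) (x : Vec D) : ‖act M x‖ ≤ specNorm M * ‖x‖ :=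
  ContinuousLinearMap.le_opNorm _ x

lemma inner_act_left {U : Mat D} (hU : U.IsHermitian) (x y : Vec D) :
    inner ℝ (act U x) y = inner ℝ x (act U y) := by
  have h : star (Matrix.toEuclideanCLM (n := Fin D) (𝕜 := ℝ) U)
      = Matrix.toEuclideanCLM (n := Fin D) (𝕜 := ℝ) U := by
    rw [← map_star]; exact congrArg _ hU
  rw [ContinuousLinearMap.star_eq_adjoint] at h
  unfold act
  conv_lhs => rw [← h]
  exact ContinuousLinearMap.adjoint_inner_left _ _ _

lemma continuous_act (M : Mat D) : Continuous (act M) :=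
  (Matrix.toEuclideanCLM (n := Fin D) (𝕜 := ℝ) M).continuous

/-! ### The energy identity -/

/-- The partial sum `∑_{1 ≤ m ≤ n} (T_m x_m - x_m)` accounts for the memory of the half steps. -/
lemma half_step_eq {α : ℝ} {T : ℕ → AffMap D} {x xh : ℕ → Vec D}
    (h0 : xh 0 = (T 0).avg α (x 0))
    (hs : ∀ n, xh (n + 1) = xh n - (T n).avg α (x n) + (T (n + 1)).app (x (n + 1))) (n : ℕ) :
    xh n = (T n).avg α (x n)
      + (1 - α) • ∑ m ∈ Finset.Icc 1 n, ((T m).app (x m) - x m) := by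
  induction n with
  | zero => simp [h0]
  | succ n ih =>
    rw [hs, Finset.sum_Icc_succ_top (by omega)]
    nth_rewrite 1 [ih]
    simp only [AffMap.avg]
    module

/-- The dual variable attached to the constraint set. -/
def dualVar (α : ℝ) (U : Mat D) (xs vs : Vec D) (x : ℕ → Vec D) (n : ℕ) : Vec D :=
  (1 - α) • act U (∑ m ∈ Finset.Icc 1 n, (x m - xs)) - vs

lemma dualVar_succ (α : ℝ) (U : Mat D) (xs vs : Vec D) (x : ℕ → Vec D) (n : ℕ) :
    dualVar α U xs vs x (n + 1)
      = dualVar α U xs vs x n + (1 - α) • act U (x (n + 1) - xs) := by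
  simp only [dualVar, Finset.sum_Icc_succ_top (Nat.le_add_left 1 n), act_add]
  module

/-- The maps `Tn` disappear: `ϑ_n` contains exactly the discrepancies that the memory of the half
step puts into `ξ_{n+1}`, with opposite sign. -/
lemma vartheta_eq {α lam : ℝ} (hlam : lam ≠ 0) {T : AffMap D} {Tn : ℕ → AffMap D}
    {x xh : ℕ → Vec D} (h0 : xh 0 = (Tn 0).avg α (x 0))
    (hs : ∀ n, xh (n + 1) = xh n - (Tn n).avg α (x n) + (Tn (n + 1)).app (x (n + 1)))
    {U : Mat D} (hU : U.IsHermitian) (hUU : U * U = 1 - T.lin) {xs : Vec D}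
    (hfix : T.app xs = xs) (vs : Vec D) (n : ℕ) :
    vartheta α lam T Tn x xh xs (-((1 / lam) • act U vs)) n
      = 2 * inner ℝ (x (n + 1) - xs) (x (n + 1) - x n)
        + 2 * α * inner ℝ (act U (x (n + 1) - xs)) (act U (x n - xs))
        + 2 * inner ℝ (act U (x (n + 1) - xs)) (dualVar α U xs vs x n) := by
  have hT : ∀ y, T.app y = y - act U (act U (y - xs)) := by
    intro y
    have h1 : act U (act U (y - xs)) = (y - xs) - act T.lin (y - xs) := by
      rw [← mul_act, hUU, sub_act, one_act]
    have h2 : act T.lin xs + T.off = xs := hfix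
    rw [h1, AffMap.app, eq_sub_of_add_eq' h2, act_sub]
    abel
  have hsum : ∑ m ∈ Finset.Icc 1 n, ((Tn m).app (x m) - x m)
      = ∑ m ∈ Finset.Icc 1 n, ((Tn m).app (x m) - T.app (x m))
        - act U (act U (∑ m ∈ Finset.Icc 1 n, (x m - xs))) := by
    have : act U (act U (∑ m ∈ Finset.Icc 1 n, (x m - xs)))
        = ∑ m ∈ Finset.Icc 1 n, act U (act U (x m - xs)) := by
      rw [act, act, map_sum, map_sum]; rfl
    rw [this, ← Finset.sum_sub_distrib]
    refine Finset.sum_congr rfl fun m _ => ?_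
    rw [hT]; abel
  have hx := half_step_eq h0 hs n
  rw [hsum] at hx
  have hvec : lam • (xiSucc lam x xh n - -((1 / lam) • act U vs))
      = α • ((Tn n).app (x n) - T.app (x n)) + (x n - x (n + 1))
        - α • act U (act U (x n - xs))
        + (1 - α) • ∑ m ∈ Finset.Icc 1 n, ((Tn m).app (x m) - T.app (x m))
        - act U (dualVar α U xs vs x n) := by
    rw [xiSucc, hx, dualVar, act_sub U _ vs, act_smul, smul_sub, smul_neg, smul_smul, smul_smul,
      mul_one_div_cancel hlam, hT (x n), AffMap.avg]
    module
  -- Affinity turns the linear-part discrepancy into a difference of map discrepancies, so that it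
  -- can cancel with the others.
  have hlin : (act (T.lin - (Tn (n + 1)).lin) (x (n + 1) - x n))
      = (T.app (x (n + 1)) - (Tn (n + 1)).app (x (n + 1)))
        - (T.app (x n) - (Tn (n + 1)).app (x n)) := by
    simp only [AffMap.app, sub_act, act_sub]; abel
  have hlast : 2 * lam * inner ℝ (xs - x (n + 1)) (xiSucc lam x xh n - -((1 / lam) • act U vs))
      = - 2 * inner ℝ (x (n + 1) - xs)
        (lam • (xiSucc lam x xh n - -((1 / lam) • act U vs))) := by
    rw [inner_smul_right, ← neg_sub, inner_neg_left]; ring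
  -- Splitting off the last summand lets the discrepancies cancel: the one at `x (n + 1)` has
  -- coefficient `2(1 - 2α) + 2α - 2(1 - α) = 0`, those at `x n` carry `±2α`, and the remaining sums
  -- over `1, …, n` are equal and opposite.
  rw [vartheta, hlast, hvec, hlin, Finset.sum_Icc_succ_top (Nat.le_add_left 1 n),
    inner_act_left hU, inner_act_left hU]
  simp only [inner_add_right, inner_sub_right, inner_smul_right]
  ring

/-- The energy of the primal-dual pair `(x_n, w_n)`. -/
def energy (α : ℝ) (U : Mat D) (xs vs : Vec D) (x : ℕ → Vec D) (n : ℕ) : ℝ :=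
  ‖x n - xs‖ ^ 2 - α * ‖act U (x n - xs)‖ ^ 2 + (1 / (1 - α)) * ‖dualVar α U xs vs x n‖ ^ 2

/-- The decrease of the energy in one step. -/
def dissipation (α : ℝ) (U : Mat D) (xs : Vec D) (x : ℕ → Vec D) (n : ℕ) : ℝ :=
  ‖x (n + 1) - x n‖ ^ 2 - α * ‖act U (x (n + 1) - x n)‖ ^ 2
    + (3 * α - 1) * ‖act U (x (n + 1) - xs)‖ ^ 2

/-- Polarization of the inner products in `vartheta_eq`. The weight `1 / (1 - α)` makes the cross
term of `‖w_{n+1}‖²` equal `2⟪U e_{n+1}, w_n⟫`; the square left over gives the coefficient `2α - (1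
- α) = 3α - 1` of the dissipation. -/
lemma energy_add_dissipation {α lam : ℝ} (hα : α ≠ 1) (hlam : lam ≠ 0) {T : AffMap D}
    {Tn : ℕ → AffMap D} {x xh : ℕ → Vec D} (h0 : xh 0 = (Tn 0).avg α (x 0))
    (hs : ∀ n, xh (n + 1) = xh n - (Tn n).avg α (x n) + (Tn (n + 1)).app (x (n + 1)))
    {U : Mat D} (hU : U.IsHermitian) (hUU : U * U = 1 - T.lin) {xs : Vec D}
    (hfix : T.app xs = xs) (vs : Vec D) (n : ℕ) :
    energy α U xs vs x (n + 1) + dissipation α U xs x n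
      = energy α U xs vs x n
        + vartheta α lam T Tn x xh xs (-((1 / lam) • act U vs)) n := by
  rw [vartheta_eq hlam h0 hs hU hUU hfix, energy, energy, dissipation, dualVar_succ]
  set e := x (n + 1) - xs with he
  set f := x n - xs with hf
  have hd : x (n + 1) - x n = e - f := by rw [he, hf]; abel
  have hα' : 1 - α ≠ 0 := sub_ne_zero.2 (Ne.symm hα)
  clear_value e f
  rw [hd, act_sub, norm_add_sq_real, norm_sub_sq_real e, norm_sub_sq_real (act U e), norm_smul, mul_pow,
    inner_smul_right, inner_sub_right, real_inner_self_eq_norm_sq,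
    real_inner_comm (dualVar α U xs vs x n), Real.norm_eq_abs, sq_abs]
  field_simp
  ring

lemma norm_act_sq {T : AffMap D} {U : Mat D} (hU : U.IsHermitian) (hUU : U * U = 1 - T.lin)
    (y : Vec D) : ‖act U y‖ ^ 2 = ‖y‖ ^ 2 - inner ℝ y (act T.lin y) := by
  rw [← real_inner_self_eq_norm_sq, inner_act_left hU, ← mul_act, hUU, sub_act, one_act,
    inner_sub_right, real_inner_self_eq_norm_sq]

/-- As `Q ≥ 0`, `U` is nonexpansive. This makes the primal parts of the energy and of the
dissipation nonnegative. -/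
lemma mul_norm_act_sq_le {α : ℝ} (hα1 : α ≤ 1) {T : AffMap D} {U : Mat D}
    (hU : U.IsHermitian) (hUU : U * U = 1 - T.lin)
    (hQ : ∀ y, 0 ≤ inner ℝ y (act T.lin y)) (y : Vec D) :
    α * ‖act U y‖ ^ 2 ≤ ‖y‖ ^ 2 := by
  have h1 := norm_act_sq hU hUU y
  have h2 := hQ y
  nlinarith [sq_nonneg ‖act U y‖]

/-! ### Measurability and second moments of the iterates -/

lemma measurable_vec [MeasurableSpace Ω] {f : Ω → Vec D} (h : ∀ i, Measurable fun ω => f ω i) :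
    Measurable f :=
  (WithLp.measurable_toLp 2 (Fin D → ℝ)).comp (measurable_pi_iff.2 h)

lemma measurable_coord [MeasurableSpace Ω] {f : Ω → Vec D} (h : Measurable f) (i : Fin D) :
    Measurable fun ω => f ω i := by
  fun_prop

lemma measurable_act [MeasurableSpace Ω] {M : Ω → Mat D} {y : Ω → Vec D}
    (hM : ∀ i j, Measurable fun ω => M ω i j) (hy : Measurable y) :
    Measurable fun ω => act (M ω) (y ω) := by
  refine measurable_vec fun i => ?_
  simp only [act_apply]
  exact Finset.measurable_sum _ fun j _ => (hM i j).mul (measurable_coord hy j)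

lemma measurable_softThreshold (lam : ℝ) : Measurable (softThreshold (D := D) lam) := by
  refine measurable_vec fun i => ?_
  simp only [softThreshold]
  fun_prop

lemma norm_softThreshold_le {lam : ℝ} (hlam : 0 < lam) (y : Vec D) :
    ‖softThreshold lam y‖ ≤ ‖y‖ := by
  rw [EuclideanSpace.norm_eq, EuclideanSpace.norm_eq]
  refine Real.sqrt_le_sqrt (Finset.sum_le_sum fun i _ => ?_)
  have hm : 0 < max lam |y i| := lt_max_of_lt_left hlam
  have h1 : lam / max lam |y i| ≤ 1 := (div_le_one hm).2 (le_max_left _ _)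
  have h0 : 0 ≤ lam / max lam |y i| := by positivity
  have h2 : |1 - lam / (max lam |y i|)| ≤ 1 := abs_le.2 ⟨by linarith, by linarith⟩
  have h3 : ‖softThreshold lam y i‖ ≤ ‖y i‖ := by
    simp only [softThreshold, norm_mul, Real.norm_eq_abs]
    exact mul_le_of_le_one_right (abs_nonneg _) h2
  gcongr

lemma memLp_app [MeasurableSpace Ω] {μ : Measure Ω} {T : Ω → AffMap D} {y : Ω → Vec D}
    (hlin : ∀ i j, Measurable fun ω => (T ω).lin i j) {K : ℝ}
    (hK : ∀ᵐ ω ∂μ, ∀ y, ‖act (T ω).lin y‖ ≤ K * ‖y‖)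
    (hoff : MemLp (fun ω => (T ω).off) 2 μ) (hym : Measurable y) (hy : MemLp y 2 μ) :
    MemLp (fun ω => (T ω).app (y ω)) 2 μ := by
  refine MemLp.add (hy.of_le_mul (c := K) (measurable_act hlin hym).aestronglyMeasurable ?_) hoff
  filter_upwards [hK] with ω h using h _

/-- Square integrability survives each step because the linear parts are almost surely bounded, the
offsets are in `L²` and thresholding shrinks norms. The bound `K` may depend on `n`: only finiteness
of each moment is needed. -/
lemma measurable_memLp_iterates [MeasurableSpace Ω] {μ : Measure Ω} [IsProbabilityMeasure μ]
    {α lam : ℝ} (hlam : 0 < lam) {T : ℕ → Ω → AffMap D} {x xh : ℕ → Ω → Vec D} {x0 : Vec D}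
    (hinit : ∀ ω, x 0 ω = x0) (h0 : ∀ ω, xh 0 ω = (T 0 ω).avg α (x 0 ω))
    (hs : ∀ ω n, xh (n + 1) ω
      = xh n ω - (T n ω).avg α (x n ω) + (T (n + 1) ω).app (x (n + 1) ω))
    (hstep : ∀ ω n, x (n + 1) ω = softThreshold lam (xh n ω))
    (hlin : ∀ n i j, Measurable fun ω => (T n ω).lin i j)
    (hoffm : ∀ n, Measurable fun ω => (T n ω).off)
    (hK : ∀ n, ∃ K : ℝ, ∀ᵐ ω ∂μ, ∀ y, ‖act (T n ω).lin y‖ ≤ K * ‖y‖)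
    (hoff : ∀ n, MemLp (fun ω => (T n ω).off) 2 μ) (n : ℕ) :
    (Measurable (x n) ∧ MemLp (x n) 2 μ) ∧ (Measurable (xh n) ∧ MemLp (xh n) 2 μ) := by
  have happ : ∀ n (y : Ω → Vec D), Measurable y → MemLp y 2 μ →
      Measurable (fun ω => (T n ω).app (y ω)) ∧ MemLp (fun ω => (T n ω).app (y ω)) 2 μ := by
    intro n y hym hy
    obtain ⟨K, hK⟩ := hK n
    exact ⟨(measurable_act (hlin n) hym).add (hoffm n), memLp_app (hlin n) hK (hoff n) hym hy⟩
  have havg : ∀ n (y : Ω → Vec D), Measurable y → MemLp y 2 μ →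
      Measurable (fun ω => (T n ω).avg α (y ω)) ∧ MemLp (fun ω => (T n ω).avg α (y ω)) 2 μ := by
    intro n y hym hy
    obtain ⟨h1, h2⟩ := happ n y hym hy
    exact ⟨(h1.const_smul α).add (hym.const_smul (1 - α)),
      (h2.const_smul α).add (hy.const_smul (1 - α))⟩
  induction n with
  | zero =>
    have e0 : x 0 = fun _ => x0 := funext hinit
    have e1 : xh 0 = fun ω => (T 0 ω).avg α (x 0 ω) := funext h0
    have hx : Measurable (x 0) ∧ MemLp (x 0) 2 μ := by
      rw [e0]; exact ⟨measurable_const, memLp_const _⟩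
    refine ⟨hx, ?_⟩
    rw [e1]; exact havg 0 _ hx.1 hx.2
  | succ n ih =>
    obtain ⟨⟨hxm, hx⟩, hhm, hh⟩ := ih
    have e0 : x (n + 1) = fun ω => softThreshold lam (xh n ω) := funext fun ω => hstep ω n
    have e1 : xh (n + 1) = fun ω => xh n ω - (T n ω).avg α (x n ω)
        + (T (n + 1) ω).app (x (n + 1) ω) := funext fun ω => hs ω n
    have hx1 : Measurable (x (n + 1)) ∧ MemLp (x (n + 1)) 2 μ := by
      rw [e0]
      have hm := (measurable_softThreshold (D := D) lam).comp hhm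
      exact ⟨hm, hh.of_le hm.aestronglyMeasurable
        (ae_of_all _ fun ω => norm_softThreshold_le hlam _)⟩
    refine ⟨hx1, ?_⟩
    rw [e1]
    obtain ⟨a1, a2⟩ := havg n _ hxm hx
    obtain ⟨b1, b2⟩ := happ (n + 1) _ hx1.1 hx1.2
    exact ⟨(hhm.sub a1).add b1, (hh.sub a2).add b2⟩

lemma memLp_act [MeasurableSpace Ω] {μ : Measure Ω} (M : Mat D) {y : Ω → Vec D}
    (hy : MemLp y 2 μ) : MemLp (fun ω => act M (y ω)) 2 μ :=
  (Matrix.toEuclideanCLM (n := Fin D) (𝕜 := ℝ) M).comp_memLp' hy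

/-! ### Almost sure convergence from the energy balance -/

lemma ae_tendsto_zero_of_sum_integral_sq_le [MeasurableSpace Ω] {μ : Measure Ω}
    {f : ℕ → Ω → Vec D} (hf : ∀ n, MemLp (f n) 2 μ) {C : ℝ}
    (hC : ∀ N, ∑ n ∈ Finset.range N, ∫ ω, ‖f n ω‖ ^ 2 ∂μ ≤ C) :
    ∀ᵐ ω ∂μ, Tendsto (fun n => f n ω) atTop (𝓝 0) := by
  have hint : ∀ n, Integrable (fun ω => ‖f n ω‖ ^ 2) μ := fun n =>
    (memLp_two_iff_integrable_sq_norm (hf n).1).1 (hf n)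
  have hm : ∀ n, AEMeasurable (fun ω => ENNReal.ofReal (‖f n ω‖ ^ 2)) μ := fun n =>
    (hint n).aestronglyMeasurable.aemeasurable.ennreal_ofReal
  have hfin : ∑' n, ∫⁻ ω, ENNReal.ofReal (‖f n ω‖ ^ 2) ∂μ ≤ ENNReal.ofReal C := by
    refine ENNReal.tsum_le_of_sum_range_le fun N => ?_
    calc ∑ n ∈ Finset.range N, ∫⁻ ω, ENNReal.ofReal (‖f n ω‖ ^ 2) ∂μ
        = ∑ n ∈ Finset.range N, ENNReal.ofReal (∫ ω, ‖f n ω‖ ^ 2 ∂μ) :=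
          Finset.sum_congr rfl fun n _ => (ofReal_integral_eq_lintegral_ofReal (hint n)
            (ae_of_all _ fun ω => sq_nonneg _)).symm
      _ = ENNReal.ofReal (∑ n ∈ Finset.range N, ∫ ω, ‖f n ω‖ ^ 2 ∂μ) :=
          (ENNReal.ofReal_sum_of_nonneg fun n _ => integral_nonneg fun ω => sq_nonneg _).symm
      _ ≤ ENNReal.ofReal C := ENNReal.ofReal_le_ofReal (hC N)
  rw [← lintegral_tsum hm] at hfin
  -- By Tonelli `∑ ‖f n‖²` has finite expectation, so it is almost surely finite and its terms tend
  -- to zero.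
  have hae := ae_lt_top' (AEMeasurable.tsum hm)
    (hfin.trans_lt ENNReal.ofReal_lt_top).ne
  filter_upwards [hae] with ω hω
  have h1 := ENNReal.tendsto_atTop_zero_of_tsum_ne_top hω.ne
  have h2 := (ENNReal.tendsto_toReal ENNReal.zero_ne_top).comp h1
  have h3 : Tendsto (fun n => ‖f n ω‖ ^ 2) atTop (𝓝 0) := by
    refine h2.congr fun n => ?_
    simp
  rw [tendsto_zero_iff_norm_tendsto_zero]
  have h4 := h3.sqrt
  simpa [Real.sqrt_sq] using h4

theorem ae_tendsto_of_domination [MeasurableSpace Ω] {μ : Measure Ω} [IsProbabilityMeasure μ]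
    {α lam : ℝ} (hα : 1 / 2 ≤ α) (hα1 : α < 1) (hlam : 0 < lam) {T : AffMap D}
    {Tn : ℕ → Ω → AffMap D} {x xh : ℕ → Ω → Vec D}
    (h0 : ∀ ω, xh 0 ω = (Tn 0 ω).avg α (x 0 ω))
    (hs : ∀ ω n, xh (n + 1) ω
      = xh n ω - (Tn n ω).avg α (x n ω) + (Tn (n + 1) ω).app (x (n + 1) ω))
    (hxm : ∀ n, Measurable (x n)) (hx : ∀ n, MemLp (x n) 2 μ)
    (hQ : ∀ y, 0 ≤ inner ℝ y (act T.lin y)) (hdet : (1 - T.lin).det ≠ 0)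
    {U : Mat D} (hU : U.IsHermitian) (hUU : U * U = 1 - T.lin) {xs vs : Vec D}
    (hfix : T.app xs = xs) {ψ : Ω → ℝ} (hψ : Integrable ψ μ)
    (hdom : ∀ᵐ ω ∂μ, ∀ N : ℕ, ∑ n ∈ Finset.range N,
      max 0 (condExp (pastSigma x n) μ
        (fun ω' => vartheta α lam T (fun m => Tn m ω') (fun m => x m ω') (fun m => xh m ω')
          xs (-((1 / lam) • act U vs)) n) ω) ≤ ψ ω) :
    ∀ᵐ ω ∂μ, Tendsto (fun n => x n ω) atTop (𝓝 xs) := by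
  set V : ℕ → Ω → ℝ := fun n ω => energy α U xs vs (fun m => x m ω) n with hV
  set Δ : ℕ → Ω → ℝ := fun n ω => dissipation α U xs (fun m => x m ω) n with hΔ
  set ϑ : ℕ → Ω → ℝ := fun n ω' => vartheta α lam T (fun m => Tn m ω') (fun m => x m ω')
    (fun m => xh m ω') xs (-((1 / lam) • act U vs)) n with hϑ
  have hid : ∀ n ω, V (n + 1) ω + Δ n ω = V n ω + ϑ n ω := fun n ω =>
    energy_add_dissipation hα1.ne hlam.ne' (h0 ω) (hs ω) hU hUU hfix vs n
  have hsq : ∀ {y : Ω → Vec D}, MemLp y 2 μ → Integrable (fun ω => ‖y ω‖ ^ 2) μ := fun hy =>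
    (memLp_two_iff_integrable_sq_norm hy.1).1 hy
  have he : ∀ n, MemLp (fun ω => x n ω - xs) 2 μ := fun n => (hx n).sub (memLp_const xs)
  have hw : ∀ n, MemLp (fun ω => dualVar α U xs vs (fun m => x m ω) n) 2 μ := fun n =>
    ((memLp_act U (memLp_finsetSum _ fun m _ => he m)).const_smul (1 - α)).sub (memLp_const vs)
  have hd : ∀ n, MemLp (fun ω => x (n + 1) ω - x n ω) 2 μ := fun n => (hx (n + 1)).sub (hx n)
  have hVi : ∀ n, Integrable (V n) μ := fun n =>
    ((hsq (he n)).sub ((hsq (memLp_act U (he n))).const_mul α)).add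
      ((hsq (hw n)).const_mul (1 / (1 - α)))
  have hΔi : ∀ n, Integrable (Δ n) μ := fun n =>
    ((hsq (hd n)).sub ((hsq (memLp_act U (hd n))).const_mul α)).add
      ((hsq (memLp_act U (he (n + 1)))).const_mul (3 * α - 1))
  have hP := mul_norm_act_sq_le hα1.le hU hUU hQ
  have hV0 : ∀ n ω, 0 ≤ V n ω := fun n ω => by
    have h1 := hP (x n ω - xs)
    have h2 : 0 ≤ 1 / (1 - α) := one_div_nonneg.2 (by linarith)
    simp only [hV, energy]
    have := mul_nonneg h2 (sq_nonneg ‖dualVar α U xs vs (fun m => x m ω) n‖)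
    linarith
  have hΔ0 : ∀ n ω, (1 / 2) * ‖act U (x (n + 1) ω - xs)‖ ^ 2 ≤ Δ n ω := fun n ω => by
    have h1 := hP (x (n + 1) ω - x n ω)
    simp only [hΔ, dissipation]
    -- Here `α ≥ 1/2` enters, through `3α - 1 ≥ 1/2`.
    nlinarith [sq_nonneg ‖act U (x (n + 1) ω - xs)‖]
  have hm : ∀ n, pastSigma x n ≤ ‹MeasurableSpace Ω› := fun n =>
    (measurable_pi_iff.2 fun ν : Fin (n + 1) => hxm ν).comap_le
  set c : ℕ → Ω → ℝ := fun n => condExp (pastSigma x n) μ (ϑ n) with hc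
  have hci : ∀ n, Integrable (c n) μ := fun n => integrable_condExp
  have hcpos : ∀ n, Integrable (fun ω => max 0 (c n ω)) μ := fun n => by
    simpa only [max_comm] using (hci n).pos_part
  have hbal : ∀ n, ∫ ω, V (n + 1) ω ∂μ + ∫ ω, Δ n ω ∂μ
      ≤ ∫ ω, V n ω ∂μ + ∫ ω, max 0 (c n ω) ∂μ := by
    intro n
    -- The identity writes `ϑ n` as a combination of integrable terms, so the mean of its
    -- conditional expectation can be computed from the energies.
    have hϑe : ϑ n = fun ω => V (n + 1) ω + Δ n ω - V n ω :=
      funext fun ω => by rw [hid]; ring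
    have h1 : ∫ ω, c n ω ∂μ = ∫ ω, V (n + 1) ω ∂μ + ∫ ω, Δ n ω ∂μ - ∫ ω, V n ω ∂μ := by
      rw [hc, integral_condExp (hm n), hϑe]
      exact (integral_sub ((hVi (n + 1)).add (hΔi n)) (hVi n)).trans
        (congrArg (· - _) (integral_add (hVi (n + 1)) (hΔi n)))
    have h2 : ∫ ω, c n ω ∂μ ≤ ∫ ω, max 0 (c n ω) ∂μ :=
      integral_mono (hci n) (hcpos n) fun ω => le_max_right _ _
    linarith
  have hsum : ∀ N, ∫ ω, V N ω ∂μ + ∑ n ∈ Finset.range N, ∫ ω, Δ n ω ∂μ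
      ≤ ∫ ω, V 0 ω ∂μ + ∑ n ∈ Finset.range N, ∫ ω, max 0 (c n ω) ∂μ := by
    intro N
    induction N with
    | zero => simp
    | succ N ih =>
      rw [Finset.sum_range_succ, Finset.sum_range_succ]
      linarith [hbal N]
  have hψsum : ∀ N, ∑ n ∈ Finset.range N, ∫ ω, max 0 (c n ω) ∂μ ≤ ∫ ω, ψ ω ∂μ := by
    intro N
    rw [← integral_finsetSum _ fun n _ => hcpos n]
    refine integral_mono_ae (integrable_finsetSum _ fun n _ => hcpos n) hψ ?_
    filter_upwards [hdom] with ω h using h N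
  have hUe : ∀ᵐ ω ∂μ, Tendsto (fun n => act U (x (n + 1) ω - xs)) atTop (𝓝 0) := by
    refine ae_tendsto_zero_of_sum_integral_sq_le (fun n => memLp_act U (he (n + 1)))
      (C := 2 * (∫ ω, V 0 ω ∂μ + ∫ ω, ψ ω ∂μ)) fun N => ?_
    have h1 : ∑ n ∈ Finset.range N, ∫ ω, ‖act U (x (n + 1) ω - xs)‖ ^ 2 ∂μ
        ≤ 2 * ∑ n ∈ Finset.range N, ∫ ω, Δ n ω ∂μ := by
      rw [Finset.mul_sum]
      refine Finset.sum_le_sum fun n _ => ?_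
      rw [← integral_const_mul]
      refine integral_mono (hsq (memLp_act U (he (n + 1)))) ((hΔi n).const_mul 2) fun ω => ?_
      have := hΔ0 n ω
      simp only
      linarith
    -- The final energy is discarded from the telescoped balance.
    have h2 : 0 ≤ ∫ ω, V N ω ∂μ := integral_nonneg (hV0 N)
    linarith [hsum N, hψsum N]
  have hUdet : IsUnit U.det := by
    rw [isUnit_iff_ne_zero]
    intro h
    rw [← hUU, Matrix.det_mul, h, mul_zero] at hdet
    exact hdet rfl
  filter_upwards [hUe] with ω hω
  rw [← tendsto_add_atTop_iff_nat 1]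
  have h1 := ((continuous_act U⁻¹).tendsto 0).comp hω
  rw [act_zero] at h1
  have h2 : Tendsto (fun n => x (n + 1) ω - xs) atTop (𝓝 0) := by
    refine h1.congr fun n => ?_
    rw [Function.comp_apply, ← mul_act, Matrix.nonsing_inv_mul U hUdet, one_act]
  simpa using h2.add_const xs

/-! ### Soft thresholding as the proximal map of the `ℓ₁`-norm -/

lemma softThreshold_scalar_le {lam : ℝ} (hlam : 0 < lam) (y a : ℝ) :
    (1 / 2) * (y * (1 - lam / (max lam |y|)) - y) ^ 2 + lam * |y * (1 - lam / (max lam |y|))|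
      ≤ (1 / 2) * (a - y) ^ 2 + lam * |a| := by
  rcases le_or_gt |y| lam with h | h
  · rw [max_eq_left h, div_self hlam.ne']
    have h1 : a * y ≤ |a| * |y| := by rw [← abs_mul]; exact le_abs_self _
    have h2 : |a| * |y| ≤ |a| * lam := by gcongr
    simp only [sub_self, mul_zero, abs_zero]
    nlinarith [sq_nonneg a]
  · rw [max_eq_right h.le]
    rcases le_or_gt 0 y with hy | hy
    · rw [abs_of_nonneg hy] at h ⊢
      have : y * (1 - lam / y) = y - lam := by field_simp [(hlam.trans h).ne']
      rw [this, abs_of_nonneg (by linarith)]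
      nlinarith [sq_nonneg (a - y + lam), le_abs_self a]
    · rw [abs_of_neg hy] at h ⊢
      have : y * (1 - lam / -y) = y + lam := by
        field_simp [hy.ne]
        ring
      rw [this, abs_of_nonpos (by linarith)]
      nlinarith [sq_nonneg (a - y - lam), neg_abs_le a]

lemma softThreshold_minimizes {lam : ℝ} (hlam : 0 < lam) (y a : Vec D) :
    (1 / 2) * ‖softThreshold lam y - y‖ ^ 2 + lam * l1 (softThreshold lam y)
      ≤ (1 / 2) * ‖a - y‖ ^ 2 + lam * l1 a := by
  simp only [EuclideanSpace.norm_sq_eq, l1, Finset.mul_sum, ← Finset.sum_add_distrib]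
  refine Finset.sum_le_sum fun i _ => ?_
  simp only [PiLp.sub_apply, Real.norm_eq_abs, sq_abs, softThreshold]
  exact softThreshold_scalar_le hlam (y i) (a i)

/-- A strict minimizer must coincide with any other minimizer, and soft thresholding is one because
the objective decouples over coordinates. -/
lemma IsProx.eq_softThreshold {lam : ℝ} (hlam : 0 < lam) {y z : Vec D}
    (h : IsProx lam l1 y z) : z = softThreshold lam y := by
  by_contra hne
  exact absurd (h _ (Ne.symm hne)) (not_lt.2 (softThreshold_minimizes hlam y z))

/-! ### Nonsingularity and resolvents of monotone matrices -/

lemma det_ne_zero_of_act {M : Mat D} (h : ∀ y, act M y = 0 → y = 0) : M.det ≠ 0 := by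
  intro hdet
  obtain ⟨v, hv, hMv⟩ := Matrix.exists_mulVec_eq_zero_iff.2 hdet
  refine hv (WithLp.toLp_injective 2 ?_)
  rw [h (WithLp.toLp 2 v) (by rw [act, Matrix.toEuclideanCLM_toLp, hMv]; rfl)]
  rfl

lemma act_injective {M : Mat D} (h : M.det ≠ 0) : Function.Injective (act M) := by
  intro x y hxy
  have := congrArg (act M⁻¹) hxy
  simpa only [← mul_act, Matrix.nonsing_inv_mul M (isUnit_iff_ne_zero.2 h), one_act] using this

section Resolvent

variable {M : Mat D} {κ : ℝ}

lemma det_one_add_smul_ne_zero (hM : ∀ y, 0 ≤ inner ℝ y (act M y)) (hκ : 0 ≤ κ) :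
    (1 + κ • M).det ≠ 0 := by
  refine det_ne_zero_of_act fun y hy => ?_
  have h1 : inner ℝ y (act (1 + κ • M) y) = 0 := by rw [hy, inner_zero_right]
  rw [add_act, one_act, smul_act, inner_add_right, inner_smul_right,
    real_inner_self_eq_norm_sq] at h1
  have h2 := mul_nonneg hκ (hM y)
  have h3 : ‖y‖ ^ 2 = 0 := le_antisymm (by linarith) (sq_nonneg _)
  simpa using h3

lemma act_inv_resolvent (hM : ∀ y, 0 ≤ inner ℝ y (act M y)) (hκ : 0 ≤ κ) (y : Vec D) :
    act (1 + κ • M)⁻¹ y + κ • act M (act (1 + κ • M)⁻¹ y) = y := by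
  have h := det_one_add_smul_ne_zero hM hκ
  have h1 : act (1 + κ • M) (act (1 + κ • M)⁻¹ y) = y := by
    rw [← mul_act, Matrix.mul_nonsing_inv _ (isUnit_iff_ne_zero.2 h), one_act]
  simpa only [add_act, one_act, smul_act] using h1

/-- With `z` the resolvent of `y`, `⟪z, y⟫ = ‖z‖² + κ⟪z, M z⟫ ≥ ‖z‖²`, and Cauchy–Schwarz concludes.
Symmetry of `M` plays no role. -/
lemma norm_act_inv_le (hM : ∀ y, 0 ≤ inner ℝ y (act M y)) (hκ : 0 ≤ κ) (y : Vec D) :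
    ‖act (1 + κ • M)⁻¹ y‖ ≤ ‖y‖ := by
  have h1 := act_inv_resolvent hM hκ y
  set z := act (1 + κ • M)⁻¹ y
  have h2 : inner ℝ z y = ‖z‖ ^ 2 + κ * inner ℝ z (act M z) := by
    rw [← h1, inner_add_right, inner_smul_right, real_inner_self_eq_norm_sq]
  have h3 := real_inner_le_norm z y
  have h4 := mul_nonneg hκ (hM z)
  nlinarith [norm_nonneg z, norm_nonneg y]

lemma inner_act_inv_nonneg (hM : ∀ y, 0 ≤ inner ℝ y (act M y)) (hκ : 0 ≤ κ) (y : Vec D) :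
    0 ≤ inner ℝ y (act (1 + κ • M)⁻¹ y) := by
  have h1 := act_inv_resolvent hM hκ y
  set z := act (1 + κ • M)⁻¹ y
  have h2 : inner ℝ y z = ‖z‖ ^ 2 + κ * inner ℝ z (act M z) := by
    rw [real_inner_comm, ← h1, inner_add_right, inner_smul_right, real_inner_self_eq_norm_sq]
  rw [h2]
  have := mul_nonneg hκ (hM z)
  positivity

/-- A fixed vector `y` of the resolvent satisfies `κ M y = 0`. -/
lemma det_one_sub_inv_ne_zero (hM : ∀ y, 0 ≤ inner ℝ y (act M y)) (hκ : 0 < κ)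
    (hdet : M.det ≠ 0) : (1 - (1 + κ • M)⁻¹).det ≠ 0 := by
  refine det_ne_zero_of_act fun y hy => ?_
  rw [sub_act, one_act, sub_eq_zero] at hy
  have h1 := act_inv_resolvent hM hκ.le y
  rw [← hy, add_eq_left, smul_eq_zero_iff_right hκ.ne'] at h1
  exact act_injective hdet (h1.trans (act_zero M).symm)

end Resolvent

/-! ### Running averages and random matrices -/

lemma sum_act {ι : Type*} (s : Finset ι) (M : ι → Mat D) (y : Vec D) :
    act (∑ k ∈ s, M k) y = ∑ k ∈ s, act (M k) y := by
  simp only [act, map_sum, _root_.sum_apply]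

lemma inner_act_outer (a y : Vec D) : inner ℝ y (act (outer a) y) = (inner ℝ a y) ^ 2 := by
  have : act (outer a) y = (inner ℝ a y : ℝ) • a := by
    ext i
    simp only [act_apply, outer, Matrix.of_apply, PiLp.smul_apply, smul_eq_mul, PiLp.inner_apply,
      RCLike.inner_apply, conj_trivial, Finset.sum_mul]
    exact Finset.sum_congr rfl fun j _ => by ring
  rw [this, inner_smul_right, real_inner_comm]; ring

lemma inner_act_runR_nonneg (R0 : Mat D) (a : ℕ+ → Ω → Vec D) {n : ℕ} (hn : n ≠ 0) (ω : Ω)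
    (y : Vec D) : 0 ≤ inner ℝ y (act (runR R0 a n ω) y) := by
  rw [runR, if_neg hn, smul_act, sum_act, inner_smul_right, inner_sum]
  simp only [inner_act_outer]
  positivity

lemma measurable_runR [MeasurableSpace Ω] (R0 : Mat D) {a : ℕ+ → Ω → Vec D}
    (ha : ∀ n, Measurable (a n)) (n : ℕ) (i j : Fin D) :
    Measurable fun ω => runR R0 a n ω i j := by
  by_cases hn : n = 0
  · simp only [runR, if_pos hn]; exact measurable_const
  · simp only [runR, if_neg hn, Matrix.smul_apply, Matrix.sum_apply, outer, Matrix.of_apply]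
    exact (Finset.measurable_sum _ fun k _ =>
      (measurable_coord (ha _) i).mul (measurable_coord (ha _) j)).const_smul (1 / (n : ℝ))

lemma measurable_runr [MeasurableSpace Ω] (r0 : Vec D) {a : ℕ+ → Ω → Vec D} {b : ℕ+ → Ω → ℝ}
    (ha : ∀ n, Measurable (a n)) (hb : ∀ n, Measurable (b n)) (n : ℕ) :
    Measurable fun ω => runr r0 a b n ω := by
  by_cases hn : n = 0
  · simp only [runr, if_pos hn]; exact measurable_const
  · simp only [runr, if_neg hn]
    exact (Finset.measurable_sum _ fun k _ => (hb _).smul (ha _)).const_smul (1 / (n : ℝ))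

lemma measurable_det [MeasurableSpace Ω] {ι : Type*} [Fintype ι] [DecidableEq ι]
    {M : Ω → Matrix ι ι ℝ}
    (hM : ∀ i j, Measurable fun ω => M ω i j) : Measurable fun ω => (M ω).det := by
  simp only [Matrix.det_apply']
  exact Finset.measurable_sum _ fun σ _ =>
    (Finset.measurable_prod _ fun i _ => hM _ _).const_mul _

/-- By Cramer's rule the entries are quotients of determinants; the convention for a zero
determinant keeps the formula valid without invertibility. -/
lemma measurable_matrix_inv [MeasurableSpace Ω] {M : Ω → Mat D}
    (hM : ∀ i j, Measurable fun ω => M ω i j) (i j : Fin D) :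
    Measurable fun ω => (M ω)⁻¹ i j := by
  simp only [Matrix.inv_def, Matrix.smul_apply, Ring.inverse_eq_inv, smul_eq_mul,
    Matrix.adjugate_apply]
  refine (measurable_det hM).inv.mul (measurable_det fun k l => ?_)
  by_cases hk : k = j
  · subst hk
    simp only [Matrix.updateRow_self]; exact measurable_const
  · simp only [Matrix.updateRow_ne hk]; exact hM k l

lemma BoundedOffsetVariance.memLp_off [MeasurableSpace Ω] {μ : Measure Ω} [IsProbabilityMeasure μ]
    {T : AffMap D} {Tn : ℕ → Ω → AffMap D} (h : BoundedOffsetVariance μ T Tn)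
    (hm : ∀ n, Measurable fun ω => (Tn n ω).off) (n : ℕ) :
    MemLp (fun ω => (Tn n ω).off) 2 μ := by
  obtain ⟨C, -, hC⟩ := h
  have h1 : MemLp (fun ω => (Tn n ω).off - T.off) 2 μ := by
    refine ⟨((hm n).sub measurable_const).aestronglyMeasurable, ?_⟩
    rw [eLpNorm_lt_top_iff_lintegral_rpow_enorm_lt_top two_ne_zero ENNReal.ofNat_ne_top]
    refine lt_of_le_of_lt (le_of_eq ?_) ((hC n).trans_lt ENNReal.ofReal_lt_top)
    refine lintegral_congr fun ω => ?_
    simp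
  have h2 := h1.add (memLp_const T.off)
  have e : (fun ω => (Tn n ω).off) = (fun ω => (Tn n ω).off - T.off) + fun _ => T.off :=
    funext fun ω => (sub_add_cancel _ _).symm
  rwa [e]

/-! ### Least squares and the normal equations -/

namespace RegressionModel

variable [MeasurableSpace Ω] {μ : Measure Ω} {a : ℕ+ → Ω → Vec D} {b η : ℕ+ → Ω → ℝ}
  {θ : Vec D} {R : Mat D} {r : Vec D}

lemma integrable_inner_mul (h : RegressionModel μ a b η θ R r) (n : ℕ+) (d y : Vec D) :
    Integrable (fun ω => inner ℝ (a n ω) d * inner ℝ (a n ω) y) μ :=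
  ((h.memLp_a n).inner_const d).integrable_mul ((h.memLp_a n).inner_const y)

lemma integrable_mul_inner (h : RegressionModel μ a b η θ R r) (n : ℕ+) (d : Vec D) :
    Integrable (fun ω => b n ω * inner ℝ (a n ω) d) μ :=
  (h.memLp_b n).integrable_mul ((h.memLp_a n).inner_const d)

lemma integral_inner_mul (h : RegressionModel μ a b η θ R r) (n : ℕ+) (d y : Vec D) :
    ∫ ω, inner ℝ (a n ω) d * inner ℝ (a n ω) y ∂μ = inner ℝ d (act R y) := by
  have hij : ∀ i j, Integrable (fun ω => a n ω i * a n ω j) μ := fun i j =>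
    ((h.memLp_a n).eval_piLp i).integrable_mul ((h.memLp_a n).eval_piLp j)
  have h1 : ∀ ω, inner ℝ (a n ω) d * inner ℝ (a n ω) y
      = ∑ i, ∑ j, (d i * y j) * (a n ω i * a n ω j) := fun ω => by
    simp only [PiLp.inner_apply, RCLike.inner_apply, conj_trivial, Finset.sum_mul_sum]
    exact Finset.sum_congr rfl fun i _ => Finset.sum_congr rfl fun j _ => by ring
  simp only [h1]
  rw [integral_finsetSum _ fun i _ =>
    integrable_finsetSum _ fun j _ => (hij i j).const_mul (d i * y j)]
  simp only [PiLp.inner_apply, RCLike.inner_apply, conj_trivial, act_apply, Finset.sum_mul]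
  refine Finset.sum_congr rfl fun i _ => ?_
  rw [integral_finsetSum _ fun j _ => (hij i j).const_mul (d i * y j)]
  refine Finset.sum_congr rfl fun j _ => ?_
  rw [integral_const_mul, h.autocorr]; ring

lemma integral_mul_inner (h : RegressionModel μ a b η θ R r) (n : ℕ+) (d : Vec D) :
    ∫ ω, b n ω * inner ℝ (a n ω) d ∂μ = inner ℝ d r := by
  have hi : ∀ i, Integrable (fun ω => b n ω * a n ω i) μ := fun i =>
    (h.memLp_b n).integrable_mul ((h.memLp_a n).eval_piLp i)
  have h1 : ∀ ω, b n ω * inner ℝ (a n ω) d = ∑ i, d i * (b n ω * a n ω i) := fun ω => by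
    simp only [PiLp.inner_apply, RCLike.inner_apply, conj_trivial, Finset.mul_sum]
    exact Finset.sum_congr rfl fun i _ => by ring
  simp only [h1]
  rw [integral_finsetSum _ fun i _ => (hi i).const_mul (d i)]
  simp only [PiLp.inner_apply, RCLike.inner_apply, conj_trivial]
  refine Finset.sum_congr rfl fun i _ => ?_
  rw [integral_const_mul, h.crosscorr]; ring

lemma inner_act_nonneg (h : RegressionModel μ a b η θ R r) (y : Vec D) :
    0 ≤ inner ℝ y (act R y) := by
  rw [← h.integral_inner_mul 1 y y]
  exact integral_nonneg fun ω => mul_self_nonneg _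

/-- Constancy of the second-order statistics gives every summand the same increment, whence the
factor `n`. -/
lemma lsLoss_add_smul (h : RegressionModel μ a b η θ R r) (n : ℕ) (y d : Vec D) (t : ℝ) :
    lsLoss μ a b n (y + t • d) = lsLoss μ a b n y
      + n * (2 * t * inner ℝ d (act R y - r) + t ^ 2 * inner ℝ d (act R d)) := by
  have hL : ∀ k y, Integrable (fun ω => (inner ℝ (a k ω) y - b k ω) ^ 2) μ := fun k y =>
    (((h.memLp_a k).inner_const y).sub (h.memLp_b k)).integrable_sq
  simp only [lsLoss]
  rw [integral_finsetSum _ fun k _ => hL _ _, integral_finsetSum _ fun k _ => hL _ _]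
  have hk : ∀ k, ∫ ω, (inner ℝ (a k ω) (y + t • d) - b k ω) ^ 2 ∂μ
      = ∫ ω, (inner ℝ (a k ω) y - b k ω) ^ 2 ∂μ
        + (2 * t * inner ℝ d (act R y - r) + t ^ 2 * inner ℝ d (act R d)) := by
    intro k
    have hpt : ∀ ω, (inner ℝ (a k ω) (y + t • d) - b k ω) ^ 2
        = (inner ℝ (a k ω) y - b k ω) ^ 2
          + (2 * t * (inner ℝ (a k ω) d * inner ℝ (a k ω) y - b k ω * inner ℝ (a k ω) d)
            + t ^ 2 * (inner ℝ (a k ω) d * inner ℝ (a k ω) d)) := fun ω => by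
      rw [inner_add_right, inner_smul_right]; ring
    have i1 : Integrable (fun ω => inner ℝ (a k ω) d * inner ℝ (a k ω) y
        - b k ω * inner ℝ (a k ω) d) μ := (h.integrable_inner_mul k d y).sub (h.integrable_mul_inner k d)
    have i2 := h.integrable_inner_mul k d d
    simp only [hpt]
    have i3 : Integrable (fun ω => 2 * t * (inner ℝ (a k ω) d * inner ℝ (a k ω) y
        - b k ω * inner ℝ (a k ω) d) + t ^ 2 * (inner ℝ (a k ω) d * inner ℝ (a k ω) d)) μ :=
      (i1.const_mul (2 * t)).add (i2.const_mul (t ^ 2))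
    rw [integral_add (hL k y) i3, integral_add (i1.const_mul (2 * t)) (i2.const_mul (t ^ 2)), integral_const_mul,
      integral_const_mul, integral_sub (h.integrable_inner_mul k d y) (h.integrable_mul_inner k d),
      h.integral_inner_mul, h.integral_inner_mul, h.integral_mul_inner, inner_sub_right]
  simp only [hk, Finset.sum_add_distrib, Finset.sum_const, Finset.card_range, nsmul_eq_mul]
  ring

/-- The first-order condition at a minimizer, tested along the residual `d = R y - r`. -/
lemma act_eq_of_mem_lsArgmin (h : RegressionModel μ a b η θ R r) {n : ℕ} (hn : 1 ≤ n) {y : Vec D}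
    (hy : y ∈ lsArgmin μ a b n) : act R y = r := by
  set d := act R y - r with hd
  set q : ℝ := inner ℝ d (act R d)
  have hq : 0 ≤ q := h.inner_act_nonneg d
  have hn' : (0 : ℝ) < n := by exact_mod_cast hn
  have key : ∀ t : ℝ, 0 ≤ 2 * t * ‖d‖ ^ 2 + t ^ 2 * q := fun t => by
    have h1 := hy (y + t • d)
    rw [h.lsLoss_add_smul, ← hd, real_inner_self_eq_norm_sq] at h1
    exact nonneg_of_mul_nonneg_right (by linarith) hn'
  -- A descent step; `q + 1` in place of `q` avoids dividing by zero while still making the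
  -- increment negative when `d ≠ 0`.
  have h4 := key (-(‖d‖ ^ 2 / (q + 1)))
  have h5 : 2 * -(‖d‖ ^ 2 / (q + 1)) * ‖d‖ ^ 2 + (-(‖d‖ ^ 2 / (q + 1))) ^ 2 * q
      = -(‖d‖ ^ 2) ^ 2 * ((q + 2) / (q + 1) ^ 2) := by
    field_simp; ring
  rw [h5] at h4
  have h6 : 0 < (q + 2) / (q + 1) ^ 2 := by positivity
  have h7 : ‖d‖ = 0 := by
    by_contra hne
    have : 0 < (‖d‖ ^ 2) ^ 2 := by positivity
    nlinarith
  exact sub_eq_zero.1 (norm_eq_zero.1 h7)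

lemma isHLSSolution (h : RegressionModel μ a b η θ R r) (hR : R.det ≠ 0) {z : Vec D}
    (hz : z ∈ ⋂ n ∈ Set.Ici 1, lsArgmin μ a b n) : IsHLSSolution μ a b z := by
  have hz' : ∀ n, 1 ≤ n → z ∈ lsArgmin μ a b n := fun n hn => Set.mem_iInter₂.1 hz n hn
  refine fun n hn => ⟨hz' n hn, fun y hy => ?_⟩
  have : z = y := act_injective hR <| (h.act_eq_of_mem_lsArgmin hn (hz' n hn)).trans
    (h.act_eq_of_mem_lsArgmin hn hy).symm
  rw [this]

end RegressionModel

/-! ### From convergence to the hierarchical problem -/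

lemma clusterPointsSolveHLS_of_tendsto [MeasurableSpace Ω] {μ : Measure Ω} {a : ℕ+ → Ω → Vec D}
    {b : ℕ+ → Ω → ℝ} {x : ℕ → Ω → Vec D} {xs : Vec D} (hxs : IsHLSSolution μ a b xs)
    (h : ∀ᵐ ω ∂μ, Tendsto (fun n => x n ω) atTop (𝓝 xs)) : ClusterPointsSolveHLS μ a b x := by
  filter_upwards [h] with ω hω
  refine ⟨⟨xs, hω.mapClusterPt⟩, fun z hz => ?_⟩
  have h1 : ClusterPt z (𝓝 xs) := ClusterPt.mono hz hω
  have : z = xs := by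
    have := h1.neBot
    exact eq_of_nhds_neBot this
  rwa [this]

/-- The convergence result shared by both choices of the affine mappings. -/
theorem clusterPointsSolveHLS_of_affine [MeasurableSpace Ω] {μ : Measure Ω}
    [IsProbabilityMeasure μ] {a : ℕ+ → Ω → Vec D} {b η : ℕ+ → Ω → ℝ} {θ : Vec D} {R : Mat D}
    {r : Vec D} (hmodel : RegressionModel μ a b η θ R r) (hR : R.det ≠ 0)
    {α lam : ℝ} (hα : 1 / 2 ≤ α) (hα1 : α < 1) (hlam : 0 < lam) {T : AffMap D}
    {Tn : ℕ → Ω → AffMap D} {x xh : ℕ → Ω → Vec D}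
    {x0 : Vec D} (hinit : ∀ ω, x 0 ω = x0) (h0 : ∀ ω, xh 0 ω = (Tn 0 ω).avg α (x 0 ω))
    (hs : ∀ ω n, xh (n + 1) ω
      = xh n ω - (Tn n ω).avg α (x n ω) + (Tn (n + 1) ω).app (x (n + 1) ω))
    (hstep : ∀ ω n, x (n + 1) ω = softThreshold lam (xh n ω))
    (hlin : ∀ n i j, Measurable fun ω => (Tn n ω).lin i j)
    (hoff : ∀ n, Measurable fun ω => (Tn n ω).off)
    (hK : ∀ n, ∃ K : ℝ, ∀ᵐ ω ∂μ, ∀ y, ‖act (Tn n ω).lin y‖ ≤ K * ‖y‖)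
    (hQ : ∀ y, 0 ≤ inner ℝ y (act T.lin y)) (hdet : (1 - T.lin).det ≠ 0)
    (hfix : ∀ y, act R y = r → T.app y = y)
    (hvar : BoundedOffsetVariance μ T Tn)
    (hdom : Domination μ α lam (⋂ n ∈ Set.Ici 1, lsArgmin μ a b n) T Tn x xh) :
    ClusterPointsSolveHLS μ a b x := by
  obtain ⟨U, hU, hUU, xs, vs, hxs, -, ψ, -, -, hψ, hsum⟩ := hdom
  have hit := measurable_memLp_iterates (μ := μ) hlam hinit h0 hs hstep hlin hoff hK
    (hvar.memLp_off hoff)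
  have hRxs : act R xs = r :=
    hmodel.act_eq_of_mem_lsArgmin le_rfl (Set.mem_iInter₂.1 hxs 1 (Set.mem_Ici.2 le_rfl))
  exact clusterPointsSolveHLS_of_tendsto (hmodel.isHLSSolution hR hxs)
    (ae_tendsto_of_domination hα hα1 hlam h0 hs (fun n => (hit n).1.1)
      (fun n => (hit n).1.2) hQ hdet hU.isHermitian hUU (hfix xs hRxs) hψ hsum)

end HRLS

end

theorem corollary1 {D : ℕ} {Ω : Type*} [MeasurableSpace Ω] (μ : Measure Ω)
    [IsProbabilityMeasure μ]
    (a : ℕ+ → Ω → HRLS.Vec D) (b η : ℕ+ → Ω → ℝ) (θ : HRLS.Vec D)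
    (R : HRLS.Mat D) (r : HRLS.Vec D)
    (hmodel : HRLS.RegressionModel μ a b η θ R r)
    (R0 : HRLS.Mat D) (r0 x0 : HRLS.Vec D) (α lam ϖ : ℝ)
    (hα : 1 / 2 ≤ α) (hα1 : α < 1) (hlam : 0 < lam)
    (hergodic : HRLS.PointwiseErgodic μ R r (HRLS.runR R0 a) (HRLS.runr r0 a b))
    (hR : R.det ≠ 0)
    (hϖ : 0 < ϖ) (hϖR : HRLS.specNorm R ≤ ϖ)
    (hϖRn : ∀ n, ∀ᵐ ω ∂μ, HRLS.specNorm (HRLS.runR R0 a n ω) ≤ ϖ) :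
    -- HRLSa
    (∀ x xh : ℕ → Ω → HRLS.Vec D,
      (∀ ω, HRLS.IsHRLSa α lam ϖ (fun n => HRLS.runR R0 a n ω) (fun n => HRLS.runr r0 a b n ω) x0
        (fun n => x n ω) (fun n => xh n ω)) →
      HRLS.BoundedOffsetVariance μ (HRLS.gradMap ϖ R r)
        (fun n ω => HRLS.gradMap ϖ (HRLS.runR R0 a n ω) (HRLS.runr r0 a b n ω)) →
      HRLS.Domination μ α lam (⋂ n ∈ Set.Ici 1, HRLS.lsArgmin μ a b n) (HRLS.gradMap ϖ R r)
        (fun n ω => HRLS.gradMap ϖ (HRLS.runR R0 a n ω) (HRLS.runr r0 a b n ω)) x xh →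
      HRLS.ClusterPointsSolveHLS μ a b x) ∧
    -- HRLSb
    (∀ κ : ℝ, 0 < κ → IsUnit (1 + κ • R0) →
      ∀ x xh : ℕ → Ω → HRLS.Vec D,
      (∀ ω, HRLS.IsHRLSb α lam κ (fun n => HRLS.runR R0 a n ω) (fun n => HRLS.runr r0 a b n ω) x0
        (fun n => x n ω) (fun n => xh n ω)) →
      HRLS.BoundedOffsetVariance μ (HRLS.proxMap κ R r)
        (fun n ω => HRLS.proxMap κ (HRLS.runR R0 a n ω) (HRLS.runr r0 a b n ω)) →
      HRLS.Domination μ α lam (⋂ n ∈ Set.Ici 1, HRLS.lsArgmin μ a b n) (HRLS.proxMap κ R r)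
        (fun n ω => HRLS.proxMap κ (HRLS.runR R0 a n ω) (HRLS.runr r0 a b n ω)) x xh →
      HRLS.ClusterPointsSolveHLS μ a b x) := by 
  have hRpos := hmodel.inner_act_nonneg
  have hRn := HRLS.measurable_runR R0 hmodel.measurable_a
  have hrn := HRLS.measurable_runr r0 hmodel.measurable_a hmodel.measurable_b
  constructor
  · intro x xh hrec hvar hdom
    refine HRLS.clusterPointsSolveHLS_of_affine hmodel hR hα hα1 hlam (fun ω => (hrec ω).init)
      (fun ω => ?_) (fun ω n => ?_) (fun ω => (hrec ω).step) (fun n i j => ?_) (fun n => ?_)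
      -- The triangle inequality with `‖R_n‖ ≤ ϖ` gives the constant 2; it also covers `n = 0`,
      -- where `R0` need not be positive.
      (fun n => ⟨2, ?_⟩) (fun y => ?_) ?_ (fun y hy => ?_) hvar hdom
    · rw [(hrec ω).half_zero]
      simp only [HRLS.AffMap.avg, HRLS.AffMap.app, HRLS.gradMap, HRLS.sub_act, HRLS.one_act,
        HRLS.smul_act]
      module
    · rw [(hrec ω).half_succ]
      simp only [HRLS.AffMap.avg, HRLS.AffMap.app, HRLS.gradMap, HRLS.sub_act, HRLS.one_act,
        HRLS.smul_act]
      module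
    · exact measurable_const.sub ((hRn n i j).const_mul (1 / ϖ))
    · exact (hrn n).const_smul (1 / ϖ)
    · filter_upwards [hϖRn n] with ω hω y
      simp only [HRLS.gradMap, HRLS.sub_act, HRLS.one_act, HRLS.smul_act]
      have h1 : ‖(1 / ϖ) • HRLS.act (HRLS.runR R0 a n ω) y‖ ≤ ‖y‖ := by
        rw [norm_smul, Real.norm_of_nonneg (by positivity), one_div_mul_eq_div, div_le_iff₀' hϖ]
        exact (HRLS.norm_act_le _ y).trans (by gcongr)
      linarith [norm_sub_le y ((1 / ϖ) • HRLS.act (HRLS.runR R0 a n ω) y)]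
    · simp only [HRLS.gradMap, HRLS.sub_act, HRLS.one_act, HRLS.smul_act]
      rw [inner_sub_right, inner_smul_right, real_inner_self_eq_norm_sq, sub_nonneg,
        one_div_mul_eq_div, div_le_iff₀' hϖ]
      calc inner ℝ y (HRLS.act R y) ≤ ‖y‖ * ‖HRLS.act R y‖ := real_inner_le_norm _ _
        _ ≤ ‖y‖ * (ϖ * ‖y‖) := by
          gcongr
          exact (HRLS.norm_act_le R y).trans (by gcongr)
        _ = ϖ * ‖y‖ ^ 2 := by ring
    · simp only [HRLS.gradMap, sub_sub_cancel, Matrix.det_smul]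
      exact mul_ne_zero (pow_ne_zero _ (one_div_ne_zero hϖ.ne')) hR
    · simp only [HRLS.AffMap.app, HRLS.gradMap, HRLS.sub_act, HRLS.one_act, HRLS.smul_act, hy,
        sub_add_cancel]
  · intro κ hκ _ x xh hrec hvar hdom
    have hlin : ∀ n i j, Measurable fun ω => (1 + κ • HRLS.runR R0 a n ω)⁻¹ i j := fun n =>
      HRLS.measurable_matrix_inv fun i j =>
        measurable_const.add ((hRn n i j).const_mul κ)
    refine HRLS.clusterPointsSolveHLS_of_affine (T := HRLS.proxMap κ R r)
      (Tn := fun n ω => HRLS.proxMap κ (HRLS.runR R0 a n ω) (HRLS.runr r0 a b n ω))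
      hmodel hR hα hα1 hlam (fun ω => (hrec ω).init)
      (fun ω => (hrec ω).half_zero) (fun ω => (hrec ω).half_succ)
      (fun ω n => ((hrec ω).step n).eq_softThreshold hlam) hlin (fun n => ?_) (fun n => ?_)
      (fun y => ?_) ?_
      (fun y hy => ?_) hvar hdom
    · exact (HRLS.measurable_act (hlin n) (hrn n)).const_smul κ
    -- Averages with `n ≥ 1` are positive semidefinite and have nonexpansive resolvents. The
    -- arbitrary `R0` is deterministic, so the norm of the fixed matrix `(1 + κ • R0)⁻¹` serves as
    -- bound.
    · rcases eq_or_ne n 0 with rfl | hn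
      · exact ⟨HRLS.specNorm (1 + κ • R0)⁻¹, ae_of_all _ fun ω y => HRLS.norm_act_le _ y⟩
      · refine ⟨1, ae_of_all _ fun ω y => ?_⟩
        rw [one_mul]
        exact HRLS.norm_act_inv_le (HRLS.inner_act_runR_nonneg R0 a hn ω) hκ.le y
    · exact HRLS.inner_act_inv_nonneg hRpos hκ.le y
    · exact HRLS.det_one_sub_inv_ne_zero hRpos hκ hR
    · have hdet := HRLS.det_one_add_smul_ne_zero hRpos hκ.le
      have h1 : y + κ • r = HRLS.act (1 + κ • R) y := by
        rw [HRLS.add_act, HRLS.one_act, HRLS.smul_act, hy]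
      simp only [HRLS.AffMap.app, HRLS.proxMap]
      rw [← HRLS.act_smul, ← HRLS.act_add, h1, ← HRLS.mul_act,
        Matrix.nonsing_inv_mul _ (isUnit_iff_ne_zero.2 hdet), HRLS.one_act]
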